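/- **Conventions.** For a regular cardinal $\kappa$, $H(\kappa)$ is the set of all sets whose transitive closure has size less than $\kappa$. Whenever $H(\kappa)$ is considered it carries a well-ordering $\lhd_\kappa$, and $N\prec H(\kappa)$ means that $\langle N,\in,\lhd_\kappa\rangle$ is an elementary substructure of $\langle H(\kappa),\in,\lhd_\kappa\rangle$. Let $\mathcal S$ be the set of all countable $M\prec H(\omega_1)$. **The forcing.** $\mathbb P$ is the set of all pairs $p=\langle\mathcal M_p,f_p\rangle$ such that $\mathcal M_p=\{M^p_0\in M^p_1\in\dots\in M^p_{n_p-1}\}$ is a finite (possibly empty) $\in$-increasing sequence of elements of $\mathcal S$ and $f_p:\mathcal M_p\to H(\omega_1)$ is a function such that $f_p(M^p_i)$ is a finite subset of $M^p_{i+1}$ if $i<n_p-1$, and $f_p(M^p_{n_p-1})$ is a finite subset of $H(\omega_1)$. Put $q\le p$ if and only if $\mathcal M_p\subseteq\mathcal M_q$ and $f_p(M)\subseteq f_q(M)$ for every $M\in\mathcal M_p$. **Strong properness.** A regular cardinal $\kappa$ is large enough for a notion of forcing $\mathbb Q$ if $\kappa>(2^{|\mathrm{tr}(\mathbb Q)|})^+$,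 where $\mathrm{tr}(\mathbb Q)$ is the transitive closure of $\mathbb Q$ (conditions together with the order). For $N\prec H(\kappa)$ with $\mathbb Q\in N$, a condition $q\in\mathbb Q$ is strongly $(N,\mathbb Q)$-generic if for every dense open subset $D$ of $\mathbb Q\cap N$ and every $r\in\mathbb Q$ with $r\le q$ there are $s\in\mathbb Q$ and $t\in D$ with $s\le r$ and $s\le t$. $\mathbb Q$ is strongly proper if for every large enough regular $\kappa$ (and every well-ordering $\lhd_\kappa$) there are club many countable $N\subseteq H(\kappa)$ such that, if $N\prec H(\kappa)$ and $\mathbb Q\in N$, then every $p\in\mathbb Q\cap N$ has a strongly $(N,\mathbb Q)$-generic extension. **Lemma.** $\mathbb P$ is a notion of forcing (a nonempty preorder) and it is strongly proper. Moreover, for every large enough regular $\kappa$, every countable $N\prec H(\kappa)$ with $\mathbb P\in N$, and every $p\in\mathbb P\cap N$, the pair $$p'=\bigl\langle \mathcal M_p\cup\{N\cap H(\omega_1)\},\ f_p\cup\{(N\cap H(\omega_1),\emptyset)\}\bigr\rangle$$ is a condition in $\mathbb P$, it extends $p$, and it is strongly $(N,\mathbb P)$-generic. No coherence between $\lhd_{\omega_1}$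 and $\lhd_\kappa$ is assumed. -/

import Mathlib

universe u

namespace AbrahamForcing

open Cardinal

noncomputable section

/-- The transitive closure of `x`: all `y` with `y ∈ x₁ ∈ ⋯ ∈ xₙ ∈ x` for some `n ≥ 0`. -/
def trcl (x : ZFSet.{u}) : ZFSet.{u} :=
  ZFSet.sep (fun y => Relation.TransGen (fun a b : ZFSet.{u} => a ∈ b) y x)
    (ZFSet.vonNeumann x.rank)

theorem mem_trcl {x y : ZFSet.{u}} :
    y ∈ trcl x ↔ Relation.TransGen (fun a b : ZFSet.{u} => a ∈ b) y x := by
  rw [trcl, ZFSet.mem_sep, and_iff_right_iff_imp]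
  intro h
  rw [ZFSet.mem_vonNeumann]
  induction h with
  | single h => exact ZFSet.rank_lt_of_mem h
  | tail _ h ih => exact ih.trans (ZFSet.rank_lt_of_mem h)

theorem exists_rank_eq (x : ZFSet.{u}) :
    ∀ o < x.rank, ∃ y ∈ trcl x, y.rank = o := by
  induction x using ZFSet.inductionOn with
  | _ x ih =>
    intro o ho
    obtain ⟨y, hy, hoy⟩ := ZFSet.lt_rank_iff.1 ho
    rcases hoy.eq_or_lt with h | h
    · exact ⟨y, mem_trcl.2 (.single hy), h.symm⟩
    · obtain ⟨z, hz, hzo⟩ := ih y hy o h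
      exact ⟨z, mem_trcl.2 ((mem_trcl.1 hz).tail hy), hzo⟩

theorem card_rank_le (x : ZFSet.{u}) : x.rank.card ≤ (trcl x).card := by
  let _ : ZFSet.Definable₁ (fun y : ZFSet.{u} => y.rank.toZFSet) :=
    Classical.allZFSetDefinable _
  rw [← Ordinal.card_toZFSet]
  refine (ZFSet.card_mono ?_).trans
    (ZFSet.card_image_le (f := fun y : ZFSet.{u} => y.rank.toZFSet) (x := trcl x))
  intro z hz
  obtain ⟨a, ha, rfl⟩ := Ordinal.mem_toZFSet_iff.1 hz
  obtain ⟨y, hy, rfl⟩ := exists_rank_eq x a ha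
  exact ZFSet.mem_image.2 ⟨y, hy, rfl⟩

/-- `H(κ)`: the set of all sets whose transitive closure has size less than `κ`
(see `mem_H`; the stage of the von Neumann hierarchy only serves to make it a set). -/
def H (κ : Cardinal.{u}) : ZFSet.{u} :=
  ZFSet.sep (fun x => (trcl x).card < κ) (ZFSet.vonNeumann κ.ord)

theorem mem_H {κ : Cardinal.{u}} {x : ZFSet.{u}} : x ∈ H κ ↔ (trcl x).card < κ := by
  rw [H, ZFSet.mem_sep, and_iff_right_iff_imp]
  intro h
  rw [ZFSet.mem_vonNeumann, Cardinal.lt_ord]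
  exact (card_rank_le x).trans_lt h

/-- The symbols of the language of set theory with an additional binary relation symbol. -/
inductive SetRel : ℕ → Type
  | mem : SetRel 2
  | wo : SetRel 2

/-- The first-order language with two binary relation symbols, for `∈` and a well-ordering. -/
def setLang : FirstOrder.Language.{0, 0} := ⟨fun _ => Empty, SetRel⟩

/-- The universe of the structure `⟨A, ∈, lt⟩`. -/
def Model (A : ZFSet.{u}) (_lt : A → A → Prop) : Type (u + 1) := A

instance (A : ZFSet.{u}) (lt : A → A → Prop) : setLang.Structure (Model A lt) where
  funMap := fun f _ => Empty.elim f
  RelMap := fun {_} r =>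
    match r with
    | SetRel.mem => fun v => Subtype.val (v 0) ∈ Subtype.val (v 1)
    | SetRel.wo => fun v => lt (v 0) (v 1)

/-- `N ≺ ⟨A, ∈, lt⟩`. -/
def IsElementary (N A : ZFSet.{u}) (lt : A → A → Prop) : Prop :=
  ∃ E : setLang.ElementarySubstructure (Model A lt),
    ∀ x : ZFSet.{u}, x ∈ N ↔ ∃ a : Model A lt, a ∈ E ∧ Subtype.val a = x

/-! Notions of forcing. A notion of forcing is coded as the set `ZFSet.pair P R`, where `P` is
the set of conditions and `R` the set of all pairs `(q, p)` with `q ≤ p`. -/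

/-- `R` is a preorder on the nonempty set `P`. -/
structure IsForcing (P R : ZFSet.{u}) : Prop where
  nonempty : P.Nonempty
  subset : R ⊆ ZFSet.prod P P
  refl : ∀ p ∈ P, ZFSet.pair p p ∈ R
  trans : ∀ p q r : ZFSet.{u}, ZFSet.pair r q ∈ R → ZFSet.pair q p ∈ R → ZFSet.pair r p ∈ R

/-- `κ` is large enough for the notion of forcing `(P, R)`. -/
def LargeEnough (P R : ZFSet.{u}) (κ : Cardinal.{u}) : Prop :=
  Order.succ ((2 : Cardinal.{u}) ^ (trcl (ZFSet.pair P R)).card) < κ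

/-- `D` is a dense open subset of `P ∩ N`, with the order induced by `R`. -/
structure IsDenseOpen (P R N : ZFSet.{u}) (D : Set ZFSet.{u}) : Prop where
  subset : ∀ d ∈ D, d ∈ P ∩ N
  dense : ∀ p ∈ P ∩ N, ∃ d ∈ D, ZFSet.pair d p ∈ R
  isOpen : ∀ d ∈ D, ∀ e ∈ P ∩ N, ZFSet.pair e d ∈ R → e ∈ D

/-- `q` is strongly `(N, P)`-generic: every dense open subset of `P ∩ N` is predense below `q`. -/
def IsStronglyGeneric (P R N q : ZFSet.{u}) : Prop :=
  q ∈ P ∧ ∀ D : Set ZFSet.{u}, IsDenseOpen P R N D →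
    ∀ r ∈ P, ZFSet.pair r q ∈ R →
      ∃ s ∈ P, ∃ t ∈ D, ZFSet.pair s r ∈ R ∧ ZFSet.pair s t ∈ R

/-- `C` is a club in the family of all countable subsets of `A`. -/
structure IsClub (A : ZFSet.{u}) (C : Set ZFSet.{u}) : Prop where
  subset : ∀ X ∈ C, X ⊆ A ∧ (X : Set ZFSet.{u}).Countable
  unbounded : ∀ X : ZFSet.{u}, X ⊆ A → (X : Set ZFSet.{u}).Countable → ∃ Y ∈ C, X ⊆ Y
  closed : ∀ X : ℕ → ZFSet.{u}, (∀ n, X n ∈ C) → (∀ n, X n ⊆ X (n + 1)) → ZFSet.iUnion X ∈ C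

/-- The notion of forcing `(P, R)` is strongly proper: for every large enough regular `κ`,
whichever well-ordering of `H(κ)` is used, club many countable `N ≺ H(κ)` containing
the notion of forcing are such that every `p ∈ P ∩ N` has a strongly generic extension. -/
def StronglyProper (P R : ZFSet.{u}) : Prop :=
  ∀ κ : Cardinal.{u}, κ.IsRegular → LargeEnough P R κ →
  ∀ lt : H κ → H κ → Prop, IsWellOrder (H κ) lt →
  ∃ C : Set ZFSet.{u}, IsClub (H κ) C ∧
    ∀ N ∈ C, IsElementary N (H κ) lt → ZFSet.pair P R ∈ N →
      ∀ p ∈ P ∩ N, ∃ q, ZFSet.pair q p ∈ R ∧ IsStronglyGeneric P R N q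

/-! The forcing. Throughout, `lt` is a well-ordering of `H(ω₁)`. -/

/-- The set `𝒮` of all countable elementary substructures of `⟨H(ω₁), ∈, lt⟩`. -/
def models (lt : H ℵ₁ → H ℵ₁ → Prop) : ZFSet.{u} :=
  ZFSet.sep (fun M => (M : Set ZFSet.{u}).Countable ∧ IsElementary M (H ℵ₁) lt)
    (ZFSet.powerset (H ℵ₁))

/-- `(𝓜, f)` is a condition. The finite `∈`-increasing sequence `M₀ ∈ M₁ ∈ ⋯ ∈ Mₙ₋₁` is given
by the set `𝓜` of its terms, a finite set any two distinct elements of which are comparable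
under `∈`; by foundation, `∈` then linearly orders `𝓜`. The empty sequence is allowed. -/
structure IsCondition (lt : H ℵ₁ → H ℵ₁ → Prop) (𝓜 f : ZFSet.{u}) : Prop where
  subset : 𝓜 ⊆ models lt
  finite : (𝓜 : Set ZFSet.{u}).Finite
  chain : ∀ M ∈ 𝓜, ∀ M' ∈ 𝓜, M ∈ M' ∨ M = M' ∨ M' ∈ M
  /-- `f` is a function from `𝓜` to `H(ω₁)`. -/
  isFunc : ZFSet.IsFunc 𝓜 (H ℵ₁) f
  /-- Every value of `f` is a finite subset of `H(ω₁)`. -/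
  value : ∀ M x : ZFSet.{u}, ZFSet.pair M x ∈ f →
    (x : Set ZFSet.{u}).Finite ∧ x ⊆ H ℵ₁
  /-- `f(M)` is a subset of the next model `M'`, if there is one. -/
  value_next : ∀ M x : ZFSet.{u}, ZFSet.pair M x ∈ f → ∀ M' ∈ 𝓜, M ∈ M' →
    (∀ M'' ∈ 𝓜, ¬ (M ∈ M'' ∧ M'' ∈ M')) → x ⊆ M'

/-- The set of conditions. -/
def conditions (lt : H ℵ₁ → H ℵ₁ → Prop) : ZFSet.{u} :=
  ZFSet.sep (fun p => ∃ 𝓜 f : ZFSet.{u}, p = ZFSet.pair 𝓜 f ∧ IsCondition lt 𝓜 f)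
    (ZFSet.prod (ZFSet.powerset (models lt))
      (ZFSet.powerset (ZFSet.prod (models lt) (H ℵ₁))))

theorem pair_mem_conditions {lt : H ℵ₁ → H ℵ₁ → Prop} {𝓜 f : ZFSet.{u}} :
    ZFSet.pair 𝓜 f ∈ conditions lt ↔ IsCondition lt 𝓜 f := by
  rw [conditions, ZFSet.mem_sep]
  constructor
  · rintro ⟨-, 𝓜', f', h, hc⟩
    obtain ⟨rfl, rfl⟩ := ZFSet.pair_inj.1 h
    exact hc
  · intro hc
    refine ⟨?_, 𝓜, f, rfl, hc⟩
    rw [ZFSet.pair_mem_prod, ZFSet.mem_powerset, ZFSet.mem_powerset]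
    refine ⟨hc.subset, fun z hz => ?_⟩
    obtain ⟨a, ha, b, hb, rfl⟩ := ZFSet.mem_prod.1 (hc.isFunc.1 hz)
    exact ZFSet.pair_mem_prod.2 ⟨hc.subset ha, hb⟩

/-- `(𝓜', f') ≤ (𝓜, f)`: `𝓜 ⊆ 𝓜'` and `f(M) ⊆ f'(M)` for every `M ∈ 𝓜`. -/
def Extends (𝓜' f' 𝓜 f : ZFSet.{u}) : Prop :=
  𝓜 ⊆ 𝓜' ∧ ∀ M ∈ 𝓜, ∀ x x' : ZFSet.{u}, ZFSet.pair M x ∈ f → ZFSet.pair M x' ∈ f' → x ⊆ x'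

/-- The order of the forcing: the set of all pairs `(q, p)` of conditions with `q ≤ p`. -/
def order (lt : H ℵ₁ → H ℵ₁ → Prop) : ZFSet.{u} :=
  ZFSet.sep (fun z => ∃ 𝓜' f' 𝓜 f : ZFSet.{u},
      z = ZFSet.pair (ZFSet.pair 𝓜' f') (ZFSet.pair 𝓜 f) ∧ Extends 𝓜' f' 𝓜 f)
    (ZFSet.prod (conditions lt) (conditions lt))

end

end AbrahamForcing

namespace AbrahamForcing

open Cardinal FirstOrder

noncomputable section

/-! ### Closure properties of `H(κ)` -/

/-! Let `K = N ∩ H ℵ₁`. The argument rests on two facts: `K` is itself a model in 𝒮, and any `r ≤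
p'` splits at `K` into a part lying in `N` and a part that can be put back on top.

Since `lt₁` and `lt` are unrelated, `K ∈ 𝒮` cannot be read off from elementarity of `N` directly.
But 𝒮 is recoverable from ℙ: each model in 𝒮 occurs in a one-model condition. Hence `N`, knowing ℙ,
contains models of 𝒮 above any prescribed countable set and point (`exists_model_mem`). Countable
elements of `N` are subsets of `N` (`subset_of_countable`), so `K` is a directed union of models in
𝒮, and `inter_mem_models` follows by the Tarski–Vaught test.

If `r ≤ p'`, then `K` is one of the models of `r`. The restriction of `r` to the models in `K` is
built from finitely many elements of `N`, so it belongs to ℙ ∩ `N` (`restrict_mem`). Density of `D`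
gives `t ∈ D` below it. As `t` lives inside `K`, it amalgamates with the part of `r` from `K`
upwards (`amalgam`) to a common extension of `r` and `t`. -/

theorem trcl_subset_of_mem {x y : ZFSet.{u}} (h : x ∈ y) : trcl x ⊆ trcl y := fun _ hz =>
  mem_trcl.2 ((mem_trcl.1 hz).tail h)

theorem self_subset_trcl (x : ZFSet.{u}) : x ⊆ trcl x := fun _ hz => mem_trcl.2 (.single hz)

theorem trcl_mono {x y : ZFSet.{u}} (h : x ⊆ y) : trcl x ⊆ trcl y := by
  intro z hz
  rw [mem_trcl] at hz ⊢
  cases hz with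
  | single hz => exact .single (h hz)
  | tail hz hw => exact hz.tail (h hw)

theorem H_isTransitive (κ : Cardinal.{u}) : (H κ).IsTransitive := by
  intro y hy x hx
  rw [mem_H] at hy ⊢
  exact (ZFSet.card_mono (trcl_subset_of_mem hx)).trans_lt hy

theorem mem_H_of_mem {κ : Cardinal.{u}} {x y : ZFSet.{u}} (hx : x ∈ y) (hy : y ∈ H κ) :
    x ∈ H κ :=
  H_isTransitive κ y hy hx

theorem mem_H_of_subset {κ : Cardinal.{u}} {x y : ZFSet.{u}} (hx : x ⊆ y) (hy : y ∈ H κ) :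
    x ∈ H κ := by
  rw [mem_H] at hy ⊢
  exact (ZFSet.card_mono (trcl_mono hx)).trans_lt hy

/-- The transitive closure of `x` is `x` together with the closures of its members; by regularity a
union of fewer than `κ` sets, each smaller than `κ`, is smaller than `κ`. -/
theorem mem_H_of_subset_H {κ : Cardinal.{u}} (hκ : κ.IsRegular) (h₀ : ℵ₀ < κ) {x : ZFSet.{u}}
    (hx : x ⊆ H κ) (hc : x.card < κ) : x ∈ H κ := by
  rw [mem_H]
  have hsub : trcl x ⊆ x ∪ ZFSet.iUnion (fun y : Shrink.{u} x => trcl ((equivShrink x).symm y)) := by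
    intro z hz
    rw [mem_trcl] at hz
    rw [ZFSet.mem_union]
    cases hz with
    | single hz => exact .inl hz
    | tail hz hw =>
      refine .inr (ZFSet.mem_iUnion.2 ⟨equivShrink x ⟨_, hw⟩, ?_⟩)
      simpa using mem_trcl.2 hz
  refine (ZFSet.card_mono hsub).trans_lt (ZFSet.card_union_le.trans_lt ?_)
  refine add_lt_of_lt h₀.le hc ?_
  have := ZFSet.lift_card_iUnion_le_sum_card
    (f := fun y : Shrink.{u} x => trcl ((equivShrink x).symm y))
  simp only [Cardinal.lift_id] at this
  refine this.trans_lt (Cardinal.sum_lt_of_isRegular hκ hc fun y => ?_)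
  exact mem_H.1 (hx ((equivShrink x).symm y).2)

theorem card_le_aleph0_iff {x : ZFSet.{u}} : x.card ≤ ℵ₀ ↔ (x : Set ZFSet.{u}).Countable := by
  rw [← Cardinal.le_aleph0_iff_set_countable, ← Cardinal.lift_le_aleph0.{u, u + 1},
    ← ZFSet.cardinalMk_coe_sort]
  rfl

theorem mem_H_of_countable {κ : Cardinal.{u}} (hκ : κ.IsRegular) (h₀ : ℵ₀ < κ) {x : ZFSet.{u}}
    (hx : x ⊆ H κ) (hc : (x : Set ZFSet.{u}).Countable) : x ∈ H κ :=
  mem_H_of_subset_H hκ h₀ hx ((card_le_aleph0_iff.2 hc).trans_lt h₀)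

theorem empty_mem_H {κ : Cardinal.{u}} (hκ : κ.IsRegular) (h₀ : ℵ₀ < κ) : ∅ ∈ H κ :=
  mem_H_of_countable hκ h₀ (ZFSet.empty_subset _) (by simp)

theorem insert_mem_H {κ : Cardinal.{u}} (hκ : κ.IsRegular) (h₀ : ℵ₀ < κ) {x y : ZFSet.{u}}
    (hx : x ∈ H κ) (hy : y ∈ H κ) : insert x y ∈ H κ := by
  refine mem_H_of_subset_H hκ h₀ ?_ ?_
  · intro z hz
    rcases ZFSet.mem_insert_iff.1 hz with rfl | hz
    exacts [hx, mem_H_of_mem hz hy]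
  · refine ZFSet.card_insert_le.trans_lt (add_lt_of_lt h₀.le ?_ (one_lt_aleph0.trans h₀))
    exact (ZFSet.card_mono (self_subset_trcl y)).trans_lt (mem_H.1 hy)

theorem pair_mem_H {κ : Cardinal.{u}} (hκ : κ.IsRegular) (h₀ : ℵ₀ < κ) {x y : ZFSet.{u}}
    (hx : x ∈ H κ) (hy : y ∈ H κ) : ZFSet.pair x y ∈ H κ := by
  have h {a b : ZFSet.{u}} (ha : a ∈ H κ) (hb : b ∈ H κ) : ({a, b} : ZFSet.{u}) ∈ H κ :=
    insert_mem_H hκ h₀ ha (by simpa using insert_mem_H hκ h₀ hb (empty_mem_H hκ h₀))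
  rw [ZFSet.pair, ← ZFSet.pair_eq_singleton x]
  exact h (h hx hx) (h hx hy)

/-- Otherwise `H κ` would be a countable subset of itself, hence one of its own elements, against
foundation. -/
theorem H_infinite {κ : Cardinal.{u}} (hκ : κ.IsRegular) (h₀ : ℵ₀ < κ) :
    (H κ : Set ZFSet.{u}).Infinite := fun h =>
  ZFSet.mem_irrefl _ (mem_H_of_countable hκ h₀ (fun _ => id) h.countable)

theorem of_pair_mem_H {κ : Cardinal.{u}} {x y : ZFSet.{u}} (h : ZFSet.pair x y ∈ H κ) :
    x ∈ H κ ∧ y ∈ H κ := by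
  have : ({x, y} : ZFSet.{u}) ∈ H κ := mem_H_of_mem (by simp [ZFSet.pair]) h
  exact ⟨mem_H_of_mem (by simp) this, mem_H_of_mem (by simp) this⟩

/-! ### Definability with parameters -/

/-- The set underlying an element of `⟨A, ∈, lt⟩`. -/
def Model.val {A : ZFSet.{u}} {lt : A → A → Prop} (a : Model A lt) : ZFSet.{u} := Subtype.val a

theorem Model.val_mem {A : ZFSet.{u}} {lt : A → A → Prop} (a : Model A lt) : a.val ∈ A :=
  Subtype.property a

theorem Model.val_injective {A : ZFSet.{u}} {lt : A → A → Prop} :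
    Function.Injective (Model.val : Model A lt → ZFSet.{u}) := Subtype.val_injective

/-- The element of `⟨A, ∈, lt⟩` given by a member of `A`. -/
def Model.mk {A : ZFSet.{u}} (lt : A → A → Prop) (a : ZFSet.{u}) (h : a ∈ A) : Model A lt := ⟨a, h⟩

@[simp]
theorem Model.val_mk {A : ZFSet.{u}} (lt : A → A → Prop) (a : ZFSet.{u}) (h : a ∈ A) :
    (Model.mk lt a h).val = a := rfl

section Dfn

variable {A : ZFSet.{u}} {lt : A → A → Prop}

/-- `T` is given by a term with parameters from `N`: a variable or a parameter. -/
def IsTm (N : ZFSet.{u}) (T : (ℕ → Model A lt) → Model A lt) : Prop :=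
  (∃ i, T = fun v => v i) ∨ ∃ a, a.val ∈ N ∧ T = fun _ => a

/-- `Φ` is first-order definable with parameters from `N`. -/
def Dfn (N : ZFSet.{u}) (Φ : (ℕ → Model A lt) → Prop) : Prop :=
  {a : Model A lt | a.val ∈ N}.Definable setLang {v : ℕ → Model A lt | Φ v}

variable {N : ZFSet.{u}}

theorem IsTm.var (i : ℕ) : IsTm N (fun v : ℕ → Model A lt => v i) := .inl ⟨i, rfl⟩

theorem IsTm.const {a : Model A lt} (ha : a.val ∈ N) : IsTm N (fun _ => a) := .inr ⟨a, ha, rfl⟩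

theorem IsTm.shift {T : (ℕ → Model A lt) → Model A lt} (hT : IsTm N T) :
    IsTm N (fun v => T (fun i => v (i + 1))) := by
  rcases hT with ⟨i, rfl⟩ | ⟨a, ha, rfl⟩
  exacts [.var _, .const ha]

theorem IsTm.exists_term {T : (ℕ → Model A lt) → Model A lt} (hT : IsTm N T) :
    ∃ t : (setLang[[{a : Model A lt | a.val ∈ N}]]).Term ℕ, ∀ v, t.realize v = T v := by
  rcases hT with ⟨i, rfl⟩ | ⟨a, ha, rfl⟩
  · exact ⟨.var i, fun v => rfl⟩
  · exact ⟨(setLang.con (⟨a, ha⟩ : {a : Model A lt | a.val ∈ N})).term, fun v => by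
      simp only [Language.Term.realize_constants]; rfl⟩

variable {Φ Ψ : (ℕ → Model A lt) → Prop} {T U W : (ℕ → Model A lt) → Model A lt}

theorem Dfn.not (h : Dfn N Φ) : Dfn N (fun v => ¬ Φ v) := h.compl

theorem Dfn.and (h : Dfn N Φ) (h' : Dfn N Ψ) : Dfn N (fun v => Φ v ∧ Ψ v) := h.inter h'

theorem Dfn.or (h : Dfn N Φ) (h' : Dfn N Ψ) : Dfn N (fun v => Φ v ∨ Ψ v) := h.union h'

theorem Dfn.of_iff (h : Dfn N Φ) (h' : ∀ v, Ψ v ↔ Φ v) : Dfn N Ψ := by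
  rwa [show Ψ = Φ from funext fun v => propext (h' v)]

theorem Dfn.imp (h : Dfn N Φ) (h' : Dfn N Ψ) : Dfn N (fun v => Φ v → Ψ v) :=
  (h.not.or h').of_iff fun _ => imp_iff_not_or

theorem Dfn.iff (h : Dfn N Φ) (h' : Dfn N Ψ) : Dfn N (fun v => Φ v ↔ Ψ v) :=
  ((h.imp h').and (h'.imp h)).of_iff fun _ => iff_iff_implies_and_implies

/-- Variables are de Bruijn indices: the quantified one takes index 0 and the others move up by one.
Hence, under nested quantifiers, `.var 0` is the innermost bound variable and parameters have to be
shifted. -/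
theorem Dfn.ex {Φ : (ℕ → Model A lt) → Model A lt → Prop}
    (h : Dfn N (fun v => Φ (fun i => v (i + 1)) (v 0))) : Dfn N (fun v => ∃ a, Φ v a) := by
  obtain ⟨φ, hφ⟩ := h
  refine ⟨(φ.relabel (fun i : ℕ => Nat.casesOn i (Sum.inr 0) Sum.inl : ℕ → ℕ ⊕ Fin 1)).iExs _, ?_⟩
  ext v
  have key (w : ℕ → Model A lt) : φ.Realize w ↔ Φ (fun i => w (i + 1)) (w 0) := by
    have := Set.ext_iff.1 hφ w
    exact this.symm
  simp only [Set.mem_ofPred_eq, Language.Formula.realize_iExs, Language.Formula.realize_relabel, key]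
  constructor
  · rintro ⟨a, ha⟩
    exact ⟨fun _ => a, ha⟩
  · rintro ⟨a, ha⟩
    exact ⟨a 0, ha⟩

theorem Dfn.all {Φ : (ℕ → Model A lt) → Model A lt → Prop}
    (h : Dfn N (fun v => Φ (fun i => v (i + 1)) (v 0))) : Dfn N (fun v => ∀ a, Φ v a) :=
  (Dfn.ex (Φ := fun v a => ¬ Φ v a) h.not).not.of_iff fun _ => by simp

theorem Dfn.eq (hT : IsTm N T) (hU : IsTm N U) : Dfn N (fun v => (T v).val = (U v).val) := by
  obtain ⟨t, ht⟩ := hT.exists_term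
  obtain ⟨u, hu⟩ := hU.exists_term
  refine ⟨t.equal u, ?_⟩
  ext v
  simp [ht, hu, Model.val_injective.eq_iff]

theorem Dfn.mem (hT : IsTm N T) (hU : IsTm N U) : Dfn N (fun v => (T v).val ∈ (U v).val) := by
  obtain ⟨t, ht⟩ := hT.exists_term
  obtain ⟨u, hu⟩ := hU.exists_term
  refine ⟨Language.Relations.formula₂ (L := setLang[[{a : Model A lt | a.val ∈ N}]])
    (Sum.inl SetRel.mem) t u, ?_⟩
  ext v
  refine Iff.symm (Language.Formula.realize_rel₂.trans ?_)
  rw [ht, hu]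
  exact Iff.rfl

/-- Transitivity of `A` makes inclusion absolute: all members of an element of `A` are seen by the
structure. The same reason underlies the two lemmas that follow. -/
theorem Dfn.subset (hA : A.IsTransitive) (hT : IsTm N T) (hU : IsTm N U) :
    Dfn N (fun v => (T v).val ⊆ (U v).val) := by
  refine Dfn.of_iff (Φ := fun v => ∀ a : Model A lt, a.val ∈ (T v).val → a.val ∈ (U v).val)
    (.all (.imp (.mem (.var 0) hT.shift) (.mem (.var 0) hU.shift))) fun v => ?_
  exact ⟨fun h a ha => h ha, fun h a ha => h (.mk lt a (hA _ (T v).val_mem ha)) ha⟩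

theorem Dfn.eq_upair (hA : A.IsTransitive) (hT : IsTm N T) (hU : IsTm N U) (hW : IsTm N W) :
    Dfn N (fun v => (T v).val = {(U v).val, (W v).val}) := by
  refine Dfn.of_iff (Φ := fun v => ∀ a : Model A lt,
      a.val ∈ (T v).val ↔ a.val = (U v).val ∨ a.val = (W v).val)
    (.all (.iff (.mem (.var 0) hT.shift) (.or (.eq (.var 0) hU.shift) (.eq (.var 0) hW.shift))))
    fun v => ⟨fun h a => by rw [h]; simp, fun h => ?_⟩
  ext z
  rw [ZFSet.mem_pair]
  constructor
  · intro hz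
    exact (h (.mk lt z (hA _ (T v).val_mem hz))).1 hz
  · rintro (rfl | rfl)
    exacts [(h _).2 (.inl rfl), (h _).2 (.inr rfl)]

theorem Dfn.eq_pair (hA : A.IsTransitive) (hT : IsTm N T) (hU : IsTm N U) (hW : IsTm N W) :
    Dfn N (fun v => (T v).val = ZFSet.pair (U v).val (W v).val) := by
  refine Dfn.of_iff (Φ := fun v => ∃ a b : Model A lt, a.val = {(U v).val, (U v).val} ∧
      b.val = {(U v).val, (W v).val} ∧ (T v).val = {a.val, b.val})
    (.ex (.ex (.and (.eq_upair hA (.var 1) hU.shift.shift hU.shift.shift)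
      (.and (.eq_upair hA (.var 0) hU.shift.shift hW.shift.shift)
        (.eq_upair hA hT.shift.shift (.var 1) (.var 0)))))) fun v => ⟨fun h => ?_, ?_⟩
  · have hmem {z : ZFSet.{u}} (hz : z ∈ ZFSet.pair (U v).val (W v).val) : z ∈ A :=
      hA _ (T v).val_mem (h ▸ hz)
    exact ⟨.mk lt {(U v).val, (U v).val} (hmem (by simp [ZFSet.pair])),
      .mk lt {(U v).val, (W v).val} (hmem (by simp [ZFSet.pair])), rfl, rfl,
      by simpa [ZFSet.pair] using h⟩
  · rintro ⟨a, b, ha, hb, h⟩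
    rw [h, ha, hb, ZFSet.pair, ZFSet.pair_eq_singleton]

end Dfn

theorem IsElementary.subset {N A : ZFSet.{u}} {lt : A → A → Prop} (h : IsElementary N A lt) :
    N ⊆ A := by
  obtain ⟨E, hE⟩ := h
  intro x hx
  obtain ⟨a, -, rfl⟩ := (hE x).1 hx
  exact Subtype.property a

/-- An elementary submodel meets every nonempty set definable with parameters from it. -/
theorem IsElementary.exists_mem {N A : ZFSet.{u}} {lt : A → A → Prop} (h : IsElementary N A lt)
    {Φ : Model A lt → Prop} (hΦ : Dfn N (fun v => Φ (v 0))) (hex : ∃ a, Φ a) :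
    ∃ a, a.val ∈ N ∧ Φ a := by
  obtain ⟨E, hE⟩ := h
  have hN : {a : Model A lt | a.val ∈ N} = (E : Set (Model A lt)) := by
    ext a
    refine (hE _).trans ⟨?_, fun ha => ⟨a, ha, rfl⟩⟩
    rintro ⟨b, hb, hba⟩
    exact Subtype.val_injective hba ▸ hb
  obtain ⟨φ, hφ⟩ := hΦ
  -- Only `v 0` matters, so all free variables may be identified to give a formula in one variable.
  have key : {a : Model A lt | a.val ∈ N}.Definable₁ setLang {a | Φ a} := by
    refine ⟨φ.relabel fun _ => 0, ?_⟩
    ext v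
    simp only [Set.mem_ofPred_eq, Language.Formula.realize_relabel]
    exact Set.ext_iff.1 hφ (v ∘ fun _ => 0)
  rw [hN] at key
  obtain ⟨a, ha, haE⟩ := E.meetsDefinable _ hex key
  exact ⟨a, (hE _).2 ⟨a, haE, rfl⟩, ha⟩

/-! ### Closure of elementary submodels of `H κ` -/

section Closure

variable {κ : Cardinal.{u}} {lt : H κ → H κ → Prop} {N : ZFSet.{u}}

theorem IsElementary.empty_mem (hN : IsElementary N (H κ) lt) (hκ : κ.IsRegular) (h₀ : ℵ₀ < κ) :
    ∅ ∈ N := by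
  obtain ⟨a, ha, h⟩ := hN.exists_mem (Φ := fun a => ∀ x : Model (H κ) lt, ¬ x.val ∈ a.val)
    (.all (.not (.mem (.var 0) (.var 1))))
    ⟨.mk lt ∅ (empty_mem_H hκ h₀), fun x => ZFSet.notMem_empty _⟩
  rwa [ZFSet.eq_empty a.val |>.2 fun x hx =>
    h (.mk lt x (mem_H_of_mem hx a.val_mem)) hx] at ha

theorem IsElementary.insert_mem (hN : IsElementary N (H κ) lt) (hκ : κ.IsRegular) (h₀ : ℵ₀ < κ)
    {x y : ZFSet.{u}} (hx : x ∈ N) (hy : y ∈ N) : insert x y ∈ N := by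
  obtain ⟨a, ha, h⟩ := hN.exists_mem (Φ := fun a => ∀ z : Model (H κ) lt,
      z.val ∈ a.val ↔ z.val = (Model.mk lt x (hN.subset hx)).val ∨
        z.val ∈ (Model.mk lt y (hN.subset hy)).val)
    (.all (.iff (.mem (.var 0) (.var 1)) (.or (.eq (.var 0) (.const hx))
      (.mem (.var 0) (.const hy)))))
    ⟨.mk lt (insert x y) (insert_mem_H hκ h₀ (hN.subset hx) (hN.subset hy)), fun z => by simp⟩
  convert! ha
  ext z
  rw [ZFSet.mem_insert_iff]
  constructor
  · rintro (rfl | hz)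
    exacts [(h (.mk lt z (hN.subset hx))).2 (.inl rfl),
      (h (.mk lt z (mem_H_of_mem hz (hN.subset hy)))).2 (.inr hz)]
  · exact fun hz => (h (.mk lt z (mem_H_of_mem hz a.val_mem))).1 hz

theorem IsElementary.upair_mem (hN : IsElementary N (H κ) lt) (hκ : κ.IsRegular) (h₀ : ℵ₀ < κ)
    {x y : ZFSet.{u}} (hx : x ∈ N) (hy : y ∈ N) : ({x, y} : ZFSet.{u}) ∈ N := by
  refine hN.insert_mem hκ h₀ hx ?_
  simpa using hN.insert_mem hκ h₀ hy (hN.empty_mem hκ h₀)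

theorem IsElementary.pair_mem (hN : IsElementary N (H κ) lt) (hκ : κ.IsRegular) (h₀ : ℵ₀ < κ)
    {x y : ZFSet.{u}} (hx : x ∈ N) (hy : y ∈ N) : ZFSet.pair x y ∈ N := by
  rw [ZFSet.pair, ← ZFSet.pair_eq_singleton x]
  exact hN.upair_mem hκ h₀ (hN.upair_mem hκ h₀ hx hx) (hN.upair_mem hκ h₀ hx hy)

theorem exists_of_finite {s : Set ZFSet.{u}} (hs : s.Finite) {P : ZFSet.{u} → Prop}
    (h₀ : P ∅) (h₁ : ∀ a ∈ s, ∀ x, P x → P (insert a x)) :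
    ∃ x : ZFSet.{u}, (x : Set ZFSet.{u}) = s ∧ P x := by
  induction s, hs using Set.Finite.induction_on with
  | empty => exact ⟨∅, by simp, h₀⟩
  | @insert a s _ _ ih =>
    obtain ⟨x, hx, hP⟩ := ih fun b hb => h₁ b (.inr hb)
    exact ⟨insert a x, by rw [← hx]; ext; simp, h₁ a (.inl rfl) x hP⟩

theorem IsElementary.mem_of_finite (hN : IsElementary N (H κ) lt) (hκ : κ.IsRegular) (h₀ : ℵ₀ < κ)
    {x : ZFSet.{u}} (hx : x ⊆ N) (hf : (x : Set ZFSet.{u}).Finite) : x ∈ N := by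
  obtain ⟨y, hy, hyN⟩ := exists_of_finite (P := (· ∈ N)) hf (hN.empty_mem hκ h₀)
    fun a ha z hz => hN.insert_mem hκ h₀ (hx ha) hz
  rwa [← SetLike.coe_injective hy]

/-- Any set `r ∈ N` of ordered pairs that is a partial function can be evaluated inside `N`. -/
theorem IsElementary.apply_mem (hN : IsElementary N (H κ) lt) {r x y : ZFSet.{u}}
    (hr : r ∈ N) (hx : x ∈ N) (hxy : ZFSet.pair x y ∈ r)
    (huniq : ∀ z, ZFSet.pair x z ∈ r → z = y) : y ∈ N := by
  have hp : ZFSet.pair x y ∈ H κ := mem_H_of_mem hxy (hN.subset hr)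
  obtain ⟨a, ha, p, hp, h⟩ := hN.exists_mem (Φ := fun a => ∃ p : Model (H κ) lt,
      p.val = ZFSet.pair (Model.mk lt x (hN.subset hx)).val a.val ∧
        p.val ∈ (Model.mk lt r (hN.subset hr)).val)
    (.ex (.and (.eq_pair (H_isTransitive κ) (.var 0) (.const hx) (.var 1))
      (.mem (.var 0) (.const hr))))
    ⟨.mk lt y (of_pair_mem_H hp).2, .mk lt _ hp, rfl, hxy⟩
  rwa [← huniq a.val (hp ▸ h)]

/-- Countability is expressed here in terms of `∈` alone, without ω: an injection `i` into ℕ orders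
`M`, the relation `r` sends each element to its immediate successor, and everything is reached from
the least element `m` by closing under `r`. -/
theorem exists_successor_relation {M : ZFSet.{u}} (hc : (M : Set ZFSet.{u}).Countable)
    (hne : M.Nonempty) :
    ∃ r : ZFSet.{u}, r ⊆ ZFSet.prod M M ∧
      (∀ x y y', ZFSet.pair x y ∈ r → ZFSet.pair x y' ∈ r → y = y') ∧
      ∃ m ∈ M, ∀ X : ZFSet.{u}, m ∈ X →
        (∀ x y, ZFSet.pair x y ∈ r → x ∈ X → y ∈ X) → M ⊆ X := by
  obtain ⟨i, hi⟩ := Set.countable_iff_exists_injOn.1 hc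
  obtain ⟨r, hr, hmem⟩ : ∃ r ⊆ ZFSet.prod M M, ∀ {x y}, ZFSet.pair x y ∈ r ↔
      (x ∈ M ∧ y ∈ M) ∧ i x < i y ∧ ∀ z ∈ M, i x < i z → i y ≤ i z := by
    refine ⟨ZFSet.sep (fun p => ∃ x y, p = ZFSet.pair x y ∧
      i x < i y ∧ ∀ z ∈ M, i x < i z → i y ≤ i z) (ZFSet.prod M M), ZFSet.sep_subset, ?_⟩
    intro x y
    rw [ZFSet.mem_sep, ZFSet.pair_mem_prod]
    refine and_congr_right fun _ => ⟨?_, fun h => ⟨x, y, rfl, h⟩⟩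
    rintro ⟨x', y', h, h'⟩
    obtain ⟨rfl, rfl⟩ := ZFSet.pair_inj.1 h
    exact h'
  have hmin {S : Set ZFSet.{u}} (hS : S.Nonempty) : ∃ m ∈ S, ∀ z ∈ S, i m ≤ i z := by
    obtain ⟨m, hm, h⟩ := (measure i).wf.has_min S hS
    exact ⟨m, hm, fun z hz => not_lt.1 (h z hz)⟩
  obtain ⟨m, hm, hm'⟩ := hmin (S := (M : Set ZFSet.{u})) hne
  refine ⟨r, hr, ?_, m, hm, ?_⟩
  · intro x y y' h h'
    obtain ⟨⟨-, hy⟩, h₁, h₂⟩ := hmem.1 h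
    obtain ⟨⟨-, hy'⟩, h₁', h₂'⟩ := hmem.1 h'
    exact hi hy hy' (le_antisymm (h₂ _ hy' h₁') (h₂' _ hy h₁))
  · intro X hmX hX
    by_contra hMX
    obtain ⟨y, hyM, hyX⟩ : ∃ y, y ∈ M ∧ y ∉ X := by
      by_contra! h
      exact hMX fun y hy => h y hy
    -- Take the least `y` missed by `X`. It is not `m`, so it has an immediate predecessor; that
    -- predecessor lies in `X`, and closure under `r` puts `y` into `X`.
    obtain ⟨y, ⟨hyM, hyX⟩, hy⟩ := hmin (S := {y | y ∈ M ∧ y ∉ X}) ⟨y, hyM, hyX⟩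
    have hmy : i m < i y := lt_of_le_of_ne (hm' y hyM) fun h => hyX (hi hm hyM h ▸ hmX)
    have hbelow : ∀ z ∈ M, i z < i y → z ∈ X := fun z hz hzy => by
      by_contra hzX
      exact absurd hzy (not_lt.2 (hy z ⟨hz, hzX⟩))
    have hfin : {z | z ∈ M ∧ i z < i y}.Finite :=
      Set.Finite.of_finite_image ((Set.finite_Iio (i y)).subset (by rintro _ ⟨z, hz, rfl⟩; exact hz.2))
        (hi.mono fun z hz => hz.1)
    obtain ⟨x, ⟨hxM, hxy⟩, hx⟩ := hfin.exists_maximalFor i _ ⟨m, hm, hmy⟩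
    refine hyX (hX x y (hmem.2 ⟨⟨hxM, hyM⟩, hxy, fun z hz hxz => ?_⟩) (hbelow x hxM hxy))
    by_contra! hzy
    exact absurd (hx ⟨hz, hzy⟩ hxz.le) (not_le.2 hxz)

/-- Countable elements of an elementary submodel are subsets of it. -/
theorem IsElementary.subset_of_countable (hN : IsElementary N (H κ) lt) (hκ : κ.IsRegular)
    (h₀ : ℵ₀ < κ) {M : ZFSet.{u}} (hM : M ∈ N) (hc : (M : Set ZFSet.{u}).Countable) : M ⊆ N := by
  rcases M.eq_empty_or_nonempty with rfl | hne
  · exact ZFSet.empty_subset _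
  have hMH := hN.subset hM
  have hA := H_isTransitive κ
  obtain ⟨r, hr, hfun, m, hm, hclos⟩ := exists_successor_relation hc hne
  have hrH : r ∈ H κ := by
    refine mem_H_of_countable hκ h₀ (fun z hz => ?_) ?_
    · obtain ⟨a, ha, b, hb, rfl⟩ := ZFSet.mem_prod.1 (hr hz)
      exact pair_mem_H hκ h₀ (mem_H_of_mem ha hMH) (mem_H_of_mem hb hMH)
    · refine ((hc.prod hc).image fun p => ZFSet.pair p.1 p.2).mono fun z hz => ?_
      obtain ⟨a, ha, b, hb, rfl⟩ := ZFSet.mem_prod.1 (hr hz)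
      exact ⟨(a, b), ⟨ha, hb⟩, rfl⟩
  -- Elementarity replaces `r` by a relation in `N` with the same properties relativized to `H κ`;
  -- with this `r` as a parameter, a starting point `m ∈ N` is then chosen.
  obtain ⟨r, hrN, hrM, hfun, hclos⟩ := hN.exists_mem (Φ := fun r =>
      (∀ x y p : Model (H κ) lt, p.val = ZFSet.pair x.val y.val → p.val ∈ r.val →
        y.val ∈ (Model.mk lt M hMH).val) ∧
      (∀ x y y' p p' : Model (H κ) lt, p.val = ZFSet.pair x.val y.val →
        p'.val = ZFSet.pair x.val y'.val → p.val ∈ r.val → p'.val ∈ r.val → y.val = y'.val) ∧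
      ∃ m : Model (H κ) lt, m.val ∈ (Model.mk lt M hMH).val ∧ ∀ X : Model (H κ) lt,
        m.val ∈ X.val → (∀ x y p : Model (H κ) lt, p.val = ZFSet.pair x.val y.val →
          p.val ∈ r.val → x.val ∈ X.val → y.val ∈ X.val) → (Model.mk lt M hMH).val ⊆ X.val)
    (.and (.all (.all (.all (.imp (.eq_pair hA (.var 0) (.var 2) (.var 1))
        (.imp (.mem (.var 0) (.var 3)) (.mem (.var 1) (.const hM)))))))
      (.and (.all (.all (.all (.all (.all (.imp (.eq_pair hA (.var 1) (.var 4) (.var 3))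
        (.imp (.eq_pair hA (.var 0) (.var 4) (.var 2)) (.imp (.mem (.var 1) (.var 5))
          (.imp (.mem (.var 0) (.var 5)) (.eq (.var 3) (.var 2)))))))))))
      (.ex (.and (.mem (.var 0) (.const hM)) (.all (.imp (.mem (.var 1) (.var 0))
        (.imp (.all (.all (.all (.imp (.eq_pair hA (.var 0) (.var 2) (.var 1))
          (.imp (.mem (.var 0) (.var 5)) (.imp (.mem (.var 2) (.var 3))
            (.mem (.var 1) (.var 3))))))))
          (.subset hA (.const hM) (.var 0)))))))))
    ⟨.mk lt r hrH, fun x y p hp h => (ZFSet.pair_mem_prod.1 (hr (hp ▸ h))).2,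
      fun x y y' p p' hp hp' h h' => hfun _ _ _ (hp ▸ h) (hp' ▸ h'),
      .mk lt m (mem_H_of_mem hm hMH), hm, fun X hmX hX => hclos _ hmX fun x y hxy hx => by
        have hp := mem_H_of_mem hxy hrH
        exact hX (.mk lt x (of_pair_mem_H hp).1) (.mk lt y (of_pair_mem_H hp).2)
          (.mk lt _ hp) rfl hxy hx⟩
  obtain ⟨m, hmN, hmM, hm⟩ := hN.exists_mem (Φ := fun m => m.val ∈ (Model.mk lt M hMH).val ∧
      ∀ X : Model (H κ) lt,
        m.val ∈ X.val → (∀ x y p : Model (H κ) lt, p.val = ZFSet.pair x.val y.val →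
          p.val ∈ r.val → x.val ∈ X.val → y.val ∈ X.val) → (Model.mk lt M hMH).val ⊆ X.val)
    (.and (.mem (.var 0) (.const hM)) (.all (.imp (.mem (.var 1) (.var 0))
        (.imp (.all (.all (.all (.imp (.eq_pair hA (.var 0) (.var 2) (.var 1))
          (.imp (.mem (.var 0) (.const hrN)) (.imp (.mem (.var 2) (.var 3))
            (.mem (.var 1) (.var 3))))))))
          (.subset hA (.const hM) (.var 0))))))
    hclos
  -- Induction along `r` is applied to `X = M ∩ N`. This set need not belong to `N`; membership in
  -- `H κ` suffices. It is closed under `r` because `N` evaluates the partial function `r`.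
  have hMN : M ∩ N ∈ H κ := mem_H_of_subset (fun z hz => (ZFSet.mem_inter.1 hz).1) hMH
  have key := hm (.mk lt (M ∩ N) hMN) (ZFSet.mem_inter.2 ⟨hmM, hmN⟩) fun x y p hp hpr hx => by
    refine ZFSet.mem_inter.2 ⟨hrM x y p hp hpr, ?_⟩
    refine hN.apply_mem hrN (ZFSet.mem_inter.1 hx).2 (hp ▸ hpr) fun z hz => ?_
    have hz' := mem_H_of_mem hz r.val_mem
    exact hfun x (.mk lt z (of_pair_mem_H hz').2) y (.mk lt _ hz') p rfl hp hz hpr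
  exact fun z hz => (ZFSet.mem_inter.1 (key hz)).2

theorem IsElementary.of_pair_mem (hN : IsElementary N (H κ) lt) (hκ : κ.IsRegular) (h₀ : ℵ₀ < κ)
    {x y : ZFSet.{u}} (h : ZFSet.pair x y ∈ N) : x ∈ N ∧ y ∈ N := by
  have hup (a b : ZFSet.{u}) : (({a, b} : ZFSet.{u}) : Set ZFSet.{u}).Countable := by simp
  have h₁ : ({x, y} : ZFSet.{u}) ∈ N :=
    hN.subset_of_countable hκ h₀ h (hup _ _) (by simp [ZFSet.pair])
  have h₂ := hN.subset_of_countable hκ h₀ h₁ (hup _ _)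
  exact ⟨h₂ (by simp), h₂ (by simp)⟩

end Closure

/-! ### Existence and unions of elementary submodels -/

theorem IsElementary.of_elementarySubstructure {A : ZFSet.{u}} {lt : A → A → Prop}
    (E : setLang.ElementarySubstructure (Model A lt)) :
    IsElementary (ZFSet.sep (fun x => ∃ a : Model A lt, a ∈ E ∧ a.val = x) A) A lt := by
  refine ⟨E, fun x => ?_⟩
  rw [ZFSet.mem_sep]
  refine ⟨fun h => h.2, ?_⟩
  rintro ⟨a, ha, rfl⟩
  exact ⟨a.val_mem, a, ha, rfl⟩

theorem setLang_card_le : setLang.card ≤ ℵ₀ := by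
  have : ∀ n, Countable (setLang.Functions n) := fun n => inferInstanceAs (Countable Empty)
  have : ∀ n, Countable (setLang.Relations n) := fun n => by
    refine Function.Injective.countable
      (f := fun r : SetRel n => match r with | .mem => 0 | .wo => 1) ?_
    rintro (_ | _) (_ | _) h <;> first | rfl | exact absurd h (by decide)
  exact Cardinal.mk_le_aleph0

/-- Downward Löwenheim–Skolem. Infinitude of `A` is needed because the submodel is taken of size
exactly `ℵ₀`. -/
theorem exists_countable_isElementary {A : ZFSet.{u}} (lt : A → A → Prop)
    (hA : (A : Set ZFSet.{u}).Infinite) {X : ZFSet.{u}} (hX : X ⊆ A)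
    (hc : (X : Set ZFSet.{u}).Countable) :
    ∃ M : ZFSet.{u}, (M : Set ZFSet.{u}).Countable ∧ IsElementary M A lt ∧ X ⊆ M := by
  have hinf : Infinite (Model A lt) := hA.to_subtype
  have hs : {a : Model A lt | a.val ∈ X}.Countable :=
    Set.Countable.preimage_of_injOn hc Model.val_injective.injOn
  obtain ⟨E, hE, hcard⟩ := Language.exists_elementarySubstructure_card_eq setLang (M := Model A lt)
    {a | a.val ∈ X} (ℵ₀ : Cardinal.{0}) le_rfl
    (by rw [Cardinal.lift_aleph0, Cardinal.lift_le_aleph0]; exact hs.le_aleph0)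
    (by rw [Cardinal.lift_aleph0, Cardinal.lift_le_aleph0]; exact setLang_card_le)
    (by rw [Cardinal.lift_aleph0, Cardinal.aleph0_le_lift]; exact Cardinal.aleph0_le_mk _)
  have hEc : (E : Set (Model A lt)).Countable := by
    refine Cardinal.le_aleph0_iff_set_countable.1 ?_
    rw [Cardinal.lift_aleph0] at hcard
    exact Cardinal.lift_le_aleph0.1 hcard.le
  refine ⟨_, (hEc.image Model.val).mono fun x hx => ?_, .of_elementarySubstructure E, fun x hx => ?_⟩
  · obtain ⟨a, ha, rfl⟩ := (ZFSet.mem_sep.1 hx).2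
    exact ⟨a, ha, rfl⟩
  · exact ZFSet.mem_sep.2 ⟨hX hx, .mk lt x (hX hx), hE hx, rfl⟩

/-- A union of elementary submodels is elementary when they are suitably directed. -/
theorem IsElementary.of_directed {N A : ZFSet.{u}} {lt : A → A → Prop} (F : Set ZFSet.{u})
    (hne : F.Nonempty) (hF : ∀ M ∈ F, IsElementary M A lt) (hFN : ∀ M ∈ F, M ⊆ N)
    (hdir : ∀ M ∈ F, ∀ x ∈ N, ∃ M' ∈ F, M ⊆ M' ∧ x ∈ M') (hN : N ⊆ A) : IsElementary N A lt := by
  have hfin (s : Finset ZFSet.{u}) : (∀ x ∈ s, x ∈ N) → ∃ M ∈ F, ∀ x ∈ s, x ∈ M := by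
    classical
    induction s using Finset.induction_on with
    | empty => exact fun _ => ⟨_, hne.some_mem, by simp⟩
    | insert a s _ ih =>
      intro h
      obtain ⟨M, hM, hs⟩ := ih fun x hx => h x (Finset.mem_insert_of_mem hx)
      obtain ⟨M', hM', hsub, ha⟩ := hdir M hM a (h a (Finset.mem_insert_self a s))
      refine ⟨M', hM', fun x hx => ?_⟩
      rcases Finset.mem_insert.1 hx with rfl | hx
      exacts [ha, hsub (hs x hx)]
  let S : setLang.Substructure (Model A lt) :=
    { carrier := {a | a.val ∈ N}
      fun_mem := fun f => Empty.elim f }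
  -- Tarski–Vaught test: the finitely many parameters lie in a single `M ∈ F`, and elementarity of
  -- `M` supplies a witness in `M ⊆ N`.
  refine ⟨S.toElementarySubstructure fun n φ x a h => ?_, fun x => ⟨fun hx => ?_, ?_⟩⟩
  · classical
    obtain ⟨M, hM, hxM⟩ := hfin (Finset.univ.image fun i => (x i : Model A lt).val) fun z hz => by
      obtain ⟨i, -, rfl⟩ := Finset.mem_image.1 hz
      exact (x i).2
    obtain ⟨E, hE⟩ := hF M hM
    have hxE (i) : (x i : Model A lt) ∈ E := by
      obtain ⟨b, hb, hbx⟩ := (hE _).1 (hxM _ (Finset.mem_image_of_mem _ (Finset.mem_univ i)))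
      exact Model.val_injective hbx ▸ hb
    let x' : Fin n → E := fun i => ⟨x i, hxE i⟩
    have he : E.subtype ∘ (default : Empty → E) = default := Subsingleton.elim _ _
    have h₁ : φ.ex.Realize (E.subtype ∘ default) (E.subtype ∘ x') := by
      rw [Language.BoundedFormula.realize_ex]
      refine ⟨a, ?_⟩
      rw [he]
      exact h
    rw [E.subtype.map_boundedFormula, Language.BoundedFormula.realize_ex] at h₁
    obtain ⟨b, hb⟩ := h₁
    rw [← E.subtype.map_boundedFormula, Fin.comp_snoc] at hb
    exact ⟨⟨b, hFN M hM ((hE _).2 ⟨b, b.2, rfl⟩)⟩, he ▸ hb⟩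
  · exact ⟨.mk lt x (hN hx), hx, rfl⟩
  · rintro ⟨a, ha, rfl⟩
    exact ha

/-! ### The models -/

variable {lt₁ : H.{u} ℵ₁ → H.{u} ℵ₁ → Prop}

theorem mem_models {M : ZFSet.{u}} :
    M ∈ models lt₁ ↔ (M : Set ZFSet.{u}).Countable ∧ IsElementary M (H ℵ₁) lt₁ := by
  rw [models, ZFSet.mem_sep, ZFSet.mem_powerset, and_iff_right_iff_imp]
  exact fun h => h.2.subset

theorem mem_H_of_mem_models {M : ZFSet.{u}} (h : M ∈ models lt₁) : M ∈ H ℵ₁ :=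
  mem_H_of_countable isRegular_aleph_one aleph0_lt_aleph_one (mem_models.1 h).2.subset
    (mem_models.1 h).1

theorem subset_of_mem_models {M M' : ZFSet.{u}} (hM : M ∈ models lt₁) (hM' : M' ∈ models lt₁)
    (h : M ∈ M') : M ⊆ M' :=
  (mem_models.1 hM').2.subset_of_countable isRegular_aleph_one aleph0_lt_aleph_one h
    (mem_models.1 hM).1

theorem exists_mem_models {X : ZFSet.{u}} (hX : X ⊆ H ℵ₁) (hc : (X : Set ZFSet.{u}).Countable) :
    ∃ M ∈ models lt₁, X ⊆ M := by
  obtain ⟨M, hM, hM', hXM⟩ := exists_countable_isElementary lt₁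
    (H_infinite isRegular_aleph_one aleph0_lt_aleph_one) hX hc
  exact ⟨M, mem_models.2 ⟨hM, hM'⟩, hXM⟩

theorem isCondition_empty : IsCondition lt₁ ∅ ∅ where
  subset := ZFSet.empty_subset _
  finite := by simp
  chain := by simp
  isFunc := ⟨ZFSet.empty_subset _, by simp⟩
  value := by simp
  value_next := by simp

/-- Every model in 𝒮 occurs in some condition, so 𝒮 can be defined from the set of conditions. -/
theorem isCondition_singleton {M : ZFSet.{u}} (hM : M ∈ models lt₁) :
    IsCondition lt₁ {M} {ZFSet.pair M ∅} where
  subset := by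
    intro z hz
    rwa [ZFSet.mem_singleton.1 hz]
  finite := by simp
  chain := by simp
  isFunc := by
    constructor
    · intro z hz
      rw [ZFSet.mem_singleton.1 hz, ZFSet.pair_mem_prod]
      exact ⟨by simp, empty_mem_H isRegular_aleph_one aleph0_lt_aleph_one⟩
    · intro z hz
      rw [ZFSet.mem_singleton.1 hz]
      exact ⟨∅, by simp, by simp [ZFSet.pair_inj]⟩
  value := by
    intro M' x h
    rw [ZFSet.mem_singleton, ZFSet.pair_inj] at h
    obtain ⟨-, rfl⟩ := h
    exact ⟨by simp, ZFSet.empty_subset _⟩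
  value_next := by
    intro M' x h
    rw [ZFSet.mem_singleton, ZFSet.pair_inj] at h
    obtain ⟨-, rfl⟩ := h
    exact fun _ _ _ _ => ZFSet.empty_subset _

/-- If `κ = ℵ₀`, every model occurring in a condition would be hereditarily finite, yet some model
in 𝒮 contains a given countably infinite subset of `H ℵ₁`. -/
theorem aleph0_lt_of_conditions_mem {κ : Cardinal.{u}} (hκ : κ.IsRegular)
    (h : conditions lt₁ ∈ H κ) : ℵ₀ < κ := by
  refine lt_of_le_of_ne hκ.aleph0_le ?_
  rintro rfl
  have hinf := H_infinite.{u} isRegular_aleph_one aleph0_lt_aleph_one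
  obtain ⟨s, hs, hsinf, hsc⟩ : ∃ s ⊆ (H.{u} ℵ₁ : Set ZFSet.{u}), s.Infinite ∧ s.Countable :=
    ⟨Set.range fun n => (hinf.natEmbedding _ n : ZFSet.{u}), by
      rintro _ ⟨n, rfl⟩; exact (hinf.natEmbedding _ n).2,
      Set.infinite_range_of_injective (Subtype.val_injective.comp (hinf.natEmbedding _).injective),
      Set.countable_range _⟩
  let X : ZFSet.{u} := ZFSet.sep (· ∈ s) (H ℵ₁)
  have hXs : (X : Set ZFSet.{u}) = s := by
    ext z
    exact ZFSet.mem_sep.trans (and_iff_right_of_imp fun hz => hs hz)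
  obtain ⟨M, hM, hXM⟩ := exists_mem_models (lt₁ := lt₁) (X := X) ZFSet.sep_subset (hXs ▸ hsc)
  have h₁ : ({M} : ZFSet.{u}) ∈ H ℵ₀ :=
    (of_pair_mem_H (mem_H_of_mem (pair_mem_conditions.2 (isCondition_singleton hM)) h)).1
  have h₂ : M ∈ H ℵ₀ := mem_H_of_mem (by simp) h₁
  have h₃ : X.card < ℵ₀ :=
    (ZFSet.card_mono (hXM.trans (self_subset_trcl M))).trans_lt (mem_H.1 h₂)
  refine hsinf (hXs ▸ ?_)
  rw [← Set.finite_coe_iff, ← Cardinal.lt_aleph0_iff_finite]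
  exact ZFSet.cardinalMk_coe_sort.trans_lt (Cardinal.lift_lt_aleph0.2 h₃)

/-! ### The trace of `N` on `H ℵ₁` -/

section Trace

variable {κ : Cardinal.{u}} {lt : H κ → H κ → Prop} {N : ZFSet.{u}}

/-- Being a model of 𝒮 is replaced by occurring in a condition, which needs no parameter but the set
of conditions. A suitable `M` exists outside by Löwenheim–Skolem, so `N` contains one. -/
theorem IsElementary.exists_model_mem (hN : IsElementary N (H κ) lt)
    (hP : conditions lt₁ ∈ N) {X a : ZFSet.{u}} (hX : X ∈ N) (hXH : X ⊆ H ℵ₁)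
    (hXc : (X : Set ZFSet.{u}).Countable) (ha : a ∈ N) (haH : a ∈ H ℵ₁) :
    ∃ M ∈ models lt₁, M ∈ N ∧ X ⊆ M ∧ a ∈ M := by
  have hA := H_isTransitive κ
  have hPH := hN.subset hP
  obtain ⟨M, hM, hsub⟩ := exists_mem_models (lt₁ := lt₁) (X := insert a X)
    (fun z hz => by
      rcases ZFSet.mem_insert_iff.1 hz with rfl | hz
      exacts [haH, hXH hz])
    ((hXc.insert a).mono fun z hz => ZFSet.mem_insert_iff.1 hz)
  have hp := pair_mem_conditions.2 (isCondition_singleton hM)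
  have hpH := mem_H_of_mem hp hPH
  have h𝓜H := (of_pair_mem_H hpH).1
  obtain ⟨M, hMN, ⟨p, 𝓜, f, hp, hpair, hM⟩, hXM, haM⟩ := hN.exists_mem (Φ := fun M =>
      (∃ p 𝓜 f : Model (H κ) lt, p.val ∈ (Model.mk lt (conditions lt₁) hPH).val ∧
        p.val = ZFSet.pair 𝓜.val f.val ∧ M.val ∈ 𝓜.val) ∧
      (Model.mk lt X (hN.subset hX)).val ⊆ M.val ∧ (Model.mk lt a (hN.subset ha)).val ∈ M.val)
    (.and (.ex (.ex (.ex (.and (.mem (.var 2) (.const hP))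
        (.and (.eq_pair hA (.var 2) (.var 1) (.var 0)) (.mem (.var 3) (.var 1)))))))
      (.and (.subset hA (.const hX) (.var 0)) (.mem (.const ha) (.var 0))))
    ⟨.mk lt M (mem_H_of_mem (by simp) h𝓜H),
      ⟨.mk lt _ hpH, .mk lt _ h𝓜H, .mk lt _ (of_pair_mem_H hpH).2, hp, rfl, by simp⟩,
      fun z hz => hsub (ZFSet.mem_insert_of_mem _ hz), hsub (ZFSet.mem_insert _ _)⟩
  rw [hpair] at hp
  exact ⟨M.val, (pair_mem_conditions.1 hp).subset hM, hMN, hXM, haM⟩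

/-- The trace is the union of the models of 𝒮 that belong to `N`. They are directed: given `M` and
`x`, some model in `N` includes `M` and contains `x`. -/
theorem IsElementary.inter_mem_models (hN : IsElementary N (H κ) lt) (hκ : κ.IsRegular)
    (h₀ : ℵ₀ < κ) (hNc : (N : Set ZFSet.{u}).Countable) (hP : conditions lt₁ ∈ N) :
    N ∩ H ℵ₁ ∈ models lt₁ := by
  refine mem_models.2 ⟨hNc.mono fun z hz => (ZFSet.mem_inter.1 hz).1,
    .of_directed {M | M ∈ models lt₁ ∧ M ∈ N} ?_ (fun M hM => (mem_models.1 hM.1).2) ?_ ?_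
    fun z hz => (ZFSet.mem_inter.1 hz).2⟩
  · have he := hN.empty_mem hκ h₀
    obtain ⟨M, hM, hMN, -⟩ := hN.exists_model_mem hP he (ZFSet.empty_subset _) (by simp) he
      (empty_mem_H isRegular_aleph_one aleph0_lt_aleph_one)
    exact ⟨M, hM, hMN⟩
  · rintro M ⟨hM, hMN⟩ z hz
    exact ZFSet.mem_inter.2 ⟨hN.subset_of_countable hκ h₀ hMN (mem_models.1 hM).1 hz,
      (mem_models.1 hM).2.subset hz⟩
  · rintro M ⟨hM, hMN⟩ x hx
    obtain ⟨hxN, hxH⟩ := ZFSet.mem_inter.1 hx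
    obtain ⟨M', hM', hMN', h⟩ := hN.exists_model_mem hP hMN (mem_models.1 hM).2.subset
      (mem_models.1 hM).1 hxN hxH
    exact ⟨M', ⟨hM', hMN'⟩, h⟩

end Trace

/-! ### Operations on conditions -/

theorem IsCondition.mem_of_pair_mem {𝓜 f M x : ZFSet.{u}} (h : IsCondition lt₁ 𝓜 f)
    (hx : ZFSet.pair M x ∈ f) : M ∈ 𝓜 :=
  (ZFSet.pair_mem_prod.1 (h.isFunc.1 hx)).1

theorem IsCondition.eq_of_pair_mem {𝓜 f M x y : ZFSet.{u}} (h : IsCondition lt₁ 𝓜 f)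
    (hx : ZFSet.pair M x ∈ f) (hy : ZFSet.pair M y ∈ f) : x = y :=
  (h.isFunc.2 M (h.mem_of_pair_mem hx)).unique hx hy

theorem IsCondition.exists_pair_mem {𝓜 f M : ZFSet.{u}} (h : IsCondition lt₁ 𝓜 f)
    (hM : M ∈ 𝓜) : ∃ x, ZFSet.pair M x ∈ f :=
  (h.isFunc.2 M hM).exists

theorem IsCondition.exists_eq_pair {𝓜 f z : ZFSet.{u}} (h : IsCondition lt₁ 𝓜 f) (hz : z ∈ f) :
    ∃ M x, z = ZFSet.pair M x := by
  obtain ⟨M, -, x, -, rfl⟩ := ZFSet.mem_prod.1 (h.isFunc.1 hz)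
  exact ⟨M, x, rfl⟩

theorem isFunc_of_pairs {A B f : ZFSet.{u}} (hf : ∀ z ∈ f, ∃ M x, z = ZFSet.pair M x)
    (hB : ∀ M x, ZFSet.pair M x ∈ f → M ∈ A ∧ x ∈ B)
    (hex : ∀ M ∈ A, ∃ x, ZFSet.pair M x ∈ f)
    (huniq : ∀ M x y, ZFSet.pair M x ∈ f → ZFSet.pair M y ∈ f → x = y) : ZFSet.IsFunc A B f := by
  refine ⟨fun z hz => ?_, fun M hM => ?_⟩
  · obtain ⟨M, x, rfl⟩ := hf z hz
    exact ZFSet.pair_mem_prod.2 (hB M x hz)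
  · obtain ⟨x, hx⟩ := hex M hM
    exact ⟨x, hx, fun y hy => huniq M y x hy hx⟩

theorem mem_H_of_isValue {x : ZFSet.{u}} (h : (x : Set ZFSet.{u}).Finite ∧ x ⊆ H ℵ₁) : x ∈ H ℵ₁ :=
  mem_H_of_countable isRegular_aleph_one aleph0_lt_aleph_one h.2 h.1.countable

theorem pair_mem_order {𝓜' f' 𝓜 f : ZFSet.{u}} :
    ZFSet.pair (ZFSet.pair 𝓜' f') (ZFSet.pair 𝓜 f) ∈ order lt₁ ↔
      IsCondition lt₁ 𝓜' f' ∧ IsCondition lt₁ 𝓜 f ∧ Extends 𝓜' f' 𝓜 f := by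
  rw [order, ZFSet.mem_sep, ZFSet.pair_mem_prod, pair_mem_conditions, pair_mem_conditions, and_assoc]
  refine and_congr_right fun _ => and_congr_right fun _ =>
    ⟨?_, fun h => ⟨_, _, _, _, rfl, h⟩⟩
  rintro ⟨𝓜₁', f₁', 𝓜₁, f₁, h, hext⟩
  obtain ⟨h₁, h₂⟩ := ZFSet.pair_inj.1 h
  obtain ⟨rfl, rfl⟩ := ZFSet.pair_inj.1 h₁
  obtain ⟨rfl, rfl⟩ := ZFSet.pair_inj.1 h₂
  exact hext

theorem exists_of_mem_conditions {p : ZFSet.{u}} (hp : p ∈ conditions lt₁) :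
    ∃ 𝓜 f, p = ZFSet.pair 𝓜 f ∧ IsCondition lt₁ 𝓜 f := (ZFSet.mem_sep.1 hp).2

theorem order_subset : order lt₁ ⊆ ZFSet.prod (conditions lt₁) (conditions lt₁) :=
  ZFSet.sep_subset

theorem isForcing_order : IsForcing (conditions lt₁) (order lt₁) where
  nonempty := ⟨_, pair_mem_conditions.2 isCondition_empty⟩
  subset := order_subset
  refl := by
    intro p hp
    obtain ⟨𝓜, f, rfl, h⟩ := exists_of_mem_conditions hp
    refine pair_mem_order.2 ⟨h, h, fun _ => id, fun M _ x x' hx hx' => ?_⟩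
    rw [h.eq_of_pair_mem hx hx']
  trans := by
    intro p q r hrq hqp
    obtain ⟨hrP, hqP⟩ := ZFSet.pair_mem_prod.1 (order_subset hrq)
    obtain ⟨-, hpP⟩ := ZFSet.pair_mem_prod.1 (order_subset hqp)
    obtain ⟨𝓜p, fp, rfl, hp⟩ := exists_of_mem_conditions hpP
    obtain ⟨𝓜q, fq, rfl, hq⟩ := exists_of_mem_conditions hqP
    obtain ⟨𝓜r, fr, rfl, hr⟩ := exists_of_mem_conditions hrP
    obtain ⟨-, -, h₁⟩ := pair_mem_order.1 hrq
    obtain ⟨-, -, h₂⟩ := pair_mem_order.1 hqp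
    refine pair_mem_order.2 ⟨hr, hp, fun _ h => h₁.1 (h₂.1 h), fun M hM x x' hx hx' => ?_⟩
    obtain ⟨y, hy⟩ := hq.exists_pair_mem (h₂.1 hM)
    exact fun z hz => h₁.2 M (h₂.1 hM) y x' hy hx' (h₂.2 M hM x y hx hy hz)

/-- Adding a model on top of a condition. -/
theorem IsCondition.insert_top {𝓜 f K : ZFSet.{u}} (h : IsCondition lt₁ 𝓜 f)
    (hK : K ∈ models lt₁) (h𝓜 : 𝓜 ⊆ K) (hf : ∀ M x, ZFSet.pair M x ∈ f → x ⊆ K) :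
    IsCondition lt₁ (insert K 𝓜) (insert (ZFSet.pair K ∅) f) := by
  have hmem {M x : ZFSet.{u}} : ZFSet.pair M x ∈ (insert (ZFSet.pair K ∅) f : ZFSet.{u}) ↔
      (M = K ∧ x = ∅) ∨ ZFSet.pair M x ∈ f := by
    rw [ZFSet.mem_insert_iff, ZFSet.pair_inj]
  -- By foundation `K` is not already in `𝓜`, so the new pair does not clash with a value of `f`.
  have hKf {x : ZFSet.{u}} (hx : ZFSet.pair K x ∈ f) : False :=
    ZFSet.mem_irrefl _ (h𝓜 (h.mem_of_pair_mem hx))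
  have hvalue : ∀ M x : ZFSet.{u}, ZFSet.pair M x ∈ (insert (ZFSet.pair K ∅) f : ZFSet.{u}) →
      (x : Set ZFSet.{u}).Finite ∧ x ⊆ H ℵ₁ := by
    intro M x hx
    rcases hmem.1 hx with ⟨-, rfl⟩ | hx
    exacts [⟨by simp, ZFSet.empty_subset _⟩, h.value M x hx]
  refine ⟨?_, ?_, ?_, isFunc_of_pairs ?_ ?_ ?_ ?_, hvalue, ?_⟩
  · intro z hz
    rcases ZFSet.mem_insert_iff.1 hz with rfl | hz
    exacts [hK, h.subset hz]
  · exact (h.finite.insert K).subset fun z hz => ZFSet.mem_insert_iff.1 hz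
  · intro M hM M' hM'
    rcases ZFSet.mem_insert_iff.1 hM with hM | hM <;>
      rcases ZFSet.mem_insert_iff.1 hM' with hM' | hM'
    exacts [.inr (.inl (hM.trans hM'.symm)), .inr (.inr (hM ▸ h𝓜 hM')), .inl (hM' ▸ h𝓜 hM),
      h.chain M hM M' hM']
  · intro z hz
    rcases ZFSet.mem_insert_iff.1 hz with rfl | hz
    exacts [⟨_, _, rfl⟩, h.exists_eq_pair hz]
  · refine fun M x hx => ⟨?_, mem_H_of_isValue (hvalue M x hx)⟩
    rcases hmem.1 hx with ⟨rfl, -⟩ | hx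
    exacts [ZFSet.mem_insert _ _, ZFSet.mem_insert_of_mem _ (h.mem_of_pair_mem hx)]
  · intro M hM
    rcases ZFSet.mem_insert_iff.1 hM with rfl | hM
    · exact ⟨∅, hmem.2 (.inl ⟨rfl, rfl⟩)⟩
    · obtain ⟨x, hx⟩ := h.exists_pair_mem hM
      exact ⟨x, hmem.2 (.inr hx)⟩
  · intro M x y hx hy
    rcases hmem.1 hx with ⟨rfl, rfl⟩ | hx <;> rcases hmem.1 hy with ⟨hM, rfl⟩ | hy
    exacts [rfl, (hKf hy).elim, (hKf (hM ▸ hx)).elim, h.eq_of_pair_mem hx hy]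
  · intro M x hx M' hM' hMM' hnext
    rcases hmem.1 hx with ⟨-, rfl⟩ | hxf
    · exact ZFSet.empty_subset _
    rcases ZFSet.mem_insert_iff.1 hM' with rfl | hM'
    · exact hf M x hxf
    · exact h.value_next M x hxf M' hM' hMM' fun M'' hM'' =>
        hnext M'' (ZFSet.mem_insert_of_mem _ hM'')

theorem extends_insert_top {𝓜 f K : ZFSet.{u}} (h : IsCondition lt₁ 𝓜 f) (h𝓜 : 𝓜 ⊆ K) :
    Extends (insert K 𝓜) (insert (ZFSet.pair K ∅) f) 𝓜 f := by
  refine ⟨fun z hz => ZFSet.mem_insert_of_mem _ hz, fun M hM x x' hx hx' => ?_⟩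
  rw [ZFSet.mem_insert_iff, ZFSet.pair_inj] at hx'
  rcases hx' with ⟨rfl, -⟩ | hx'
  · exact (ZFSet.mem_irrefl _ (h𝓜 hM)).elim
  · rw [h.eq_of_pair_mem hx hx']

/-- The value at a model below `K ∈ 𝓜` is a subset of `K`. -/
theorem IsCondition.value_subset {𝓜 f K M x : ZFSet.{u}} (h : IsCondition lt₁ 𝓜 f)
    (hK : K ∈ 𝓜) (hx : ZFSet.pair M x ∈ f) (hMK : M ∈ K) : x ⊆ K := by
  -- The `∈`-minimal model above `M` is the successor of `M` in `𝓜`; it equals `K` or belongs to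
  -- `K`, and so is a subset of `K`.
  obtain ⟨M', ⟨hM', hMM'⟩, hmin⟩ :=
    ZFSet.mem_wf.has_min {M' : ZFSet.{u} | M' ∈ 𝓜 ∧ M ∈ M'} ⟨K, hK, hMK⟩
  have hsub := h.value_next M x hx M' hM' hMM' fun M'' hM'' h'' => hmin M'' ⟨hM'', h''.1⟩ h''.2
  rcases h.chain M' hM' K hK with h' | rfl | h'
  · exact hsub.trans (subset_of_mem_models (h.subset hM') (h.subset hK) h')
  · exact hsub
  · exact (hmin K ⟨hK, hMK⟩ h').elim

/-- The restriction of the function `f` to the arguments with property `Q`. -/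
def restrict (f : ZFSet.{u}) (Q : ZFSet.{u} → Prop) : ZFSet.{u} :=
  ZFSet.sep (fun z => ∃ M x, z = ZFSet.pair M x ∧ Q M) f

theorem pair_mem_restrict {f M x : ZFSet.{u}} {Q : ZFSet.{u} → Prop} :
    ZFSet.pair M x ∈ restrict f Q ↔ ZFSet.pair M x ∈ f ∧ Q M := by
  rw [restrict, ZFSet.mem_sep]
  refine and_congr_right fun _ => ⟨?_, fun h => ⟨M, x, rfl, h⟩⟩
  rintro ⟨M', x', h, hQ⟩
  rwa [(ZFSet.pair_inj.1 h).1]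

/-- The models of `𝓜` in `K` form an initial segment: anything below a member of `K` is in `K`. So
successors computed in `𝓜 ∩ K` are successors in `𝓜`. -/
theorem IsCondition.restrict {𝓜 f K : ZFSet.{u}} (h : IsCondition lt₁ 𝓜 f) (hK : K ∈ 𝓜) :
    IsCondition lt₁ (𝓜 ∩ K) (restrict f (· ∈ K)) := by
  have h𝓜 {M : ZFSet.{u}} (hM : M ∈ 𝓜 ∩ K) : M ∈ 𝓜 := (ZFSet.mem_inter.1 hM).1
  have hsub {M x : ZFSet.{u}} (hx : ZFSet.pair M x ∈ AbrahamForcing.restrict f (· ∈ K)) :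
    ZFSet.pair M x ∈ f := (pair_mem_restrict.1 hx).1
  refine ⟨fun M hM => h.subset (h𝓜 hM), h.finite.subset fun M hM => h𝓜 hM,
    fun M hM M' hM' => h.chain M (h𝓜 hM) M' (h𝓜 hM'), isFunc_of_pairs
      (fun z hz => h.exists_eq_pair (ZFSet.sep_subset hz)) ?_ ?_
      fun M x y hx hy => h.eq_of_pair_mem (hsub hx) (hsub hy),
    fun M x hx => h.value M x (hsub hx), ?_⟩
  · intro M x hx
    exact ⟨ZFSet.mem_inter.2 ⟨h.mem_of_pair_mem (hsub hx), (pair_mem_restrict.1 hx).2⟩,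
      mem_H_of_isValue (h.value M x (hsub hx))⟩
  · intro M hM
    obtain ⟨x, hx⟩ := h.exists_pair_mem (h𝓜 hM)
    exact ⟨x, pair_mem_restrict.2 ⟨hx, (ZFSet.mem_inter.1 hM).2⟩⟩
  · intro M x hx M' hM' hMM' hnext
    refine h.value_next M x (hsub hx) M' (h𝓜 hM') hMM' fun M'' hM'' h'' => ?_
    refine hnext M'' (ZFSet.mem_inter.2 ⟨hM'', ?_⟩) h''
    exact subset_of_mem_models (h.subset (h𝓜 hM')) (h.subset hK) (ZFSet.mem_inter.1 hM').2 h''.2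

/-- The amalgam of a condition `(𝓜t, ft)` living below a model `K` with a condition `(𝓜, f)`
containing `K`, the former extending the part of the latter below `K`. -/
theorem IsCondition.amalgam {𝓜 f 𝓜t ft K : ZFSet.{u}} (h : IsCondition lt₁ 𝓜 f) (hK : K ∈ 𝓜)
    (ht : IsCondition lt₁ 𝓜t ft) (h𝓜t : 𝓜t ⊆ K) (hft : ∀ M x, ZFSet.pair M x ∈ ft → x ⊆ K)
    (hext : 𝓜 ∩ K ⊆ 𝓜t) :
    IsCondition lt₁ (𝓜t ∪ 𝓜) (ft ∪ AbrahamForcing.restrict f (· ∉ K)) := by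
  have hKm := h.subset hK
  have hmem {M x : ZFSet.{u}} : ZFSet.pair M x ∈ ft ∪ AbrahamForcing.restrict f (· ∉ K) ↔
      ZFSet.pair M x ∈ ft ∨ (ZFSet.pair M x ∈ f ∧ M ∉ K) := by
    rw [ZFSet.mem_union, pair_mem_restrict]
  have habove {M : ZFSet.{u}} (hM : M ∈ 𝓜) (hMK : M ∉ K) : K ⊆ M := by
    rcases h.chain M hM K hK with h' | rfl | h'
    exacts [(hMK h').elim, fun _ => id, subset_of_mem_models hKm (h.subset hM) h']
  have hcases {M : ZFSet.{u}} (hM : M ∈ 𝓜t ∪ 𝓜) : M ∈ 𝓜t ∨ (M ∈ 𝓜 ∧ M ∉ K) := by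
    rcases ZFSet.mem_union.1 hM with hM | hM
    · exact .inl hM
    · by_cases hMK : M ∈ K
      exacts [.inl (hext (ZFSet.mem_inter.2 ⟨hM, hMK⟩)), .inr ⟨hM, hMK⟩]
  have hvalue : ∀ M x, ZFSet.pair M x ∈ ft ∪ AbrahamForcing.restrict f (· ∉ K) →
      (x : Set ZFSet.{u}).Finite ∧ x ⊆ H ℵ₁ := by
    intro M x hx
    rcases hmem.1 hx with hx | ⟨hx, -⟩
    exacts [ht.value M x hx, h.value M x hx]
  refine ⟨?_, ?_, ?_, isFunc_of_pairs ?_ ?_ ?_ ?_, hvalue, ?_⟩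
  · intro M hM
    rcases ZFSet.mem_union.1 hM with hM | hM
    exacts [ht.subset hM, h.subset hM]
  · exact (ht.finite.union h.finite).subset fun z hz => ZFSet.mem_union.1 hz
  · intro M hM M' hM'
    rcases hcases hM with hM | ⟨hM, hMK⟩ <;> rcases hcases hM' with hM' | ⟨hM', hMK'⟩
    exacts [ht.chain M hM M' hM', .inl (habove hM' hMK' (h𝓜t hM)),
      .inr (.inr (habove hM hMK (h𝓜t hM'))), h.chain M hM M' hM']
  · intro z hz
    rcases ZFSet.mem_union.1 hz with hz | hz
    exacts [ht.exists_eq_pair hz, h.exists_eq_pair (ZFSet.sep_subset hz)]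
  · refine fun M x hx => ⟨ZFSet.mem_union.2 ?_, mem_H_of_isValue (hvalue M x hx)⟩
    rcases hmem.1 hx with hx | ⟨hx, -⟩
    exacts [.inl (ht.mem_of_pair_mem hx), .inr (h.mem_of_pair_mem hx)]
  · intro M hM
    rcases hcases hM with hM | ⟨hM, hMK⟩
    · obtain ⟨x, hx⟩ := ht.exists_pair_mem hM
      exact ⟨x, hmem.2 (.inl hx)⟩
    · obtain ⟨x, hx⟩ := h.exists_pair_mem hM
      exact ⟨x, hmem.2 (.inr ⟨hx, hMK⟩)⟩
  · intro M x y hx hy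
    rcases hmem.1 hx with hx | ⟨hx, hMK⟩ <;> rcases hmem.1 hy with hy | ⟨hy, hMK'⟩
    exacts [ht.eq_of_pair_mem hx hy, (hMK' (h𝓜t (ht.mem_of_pair_mem hx))).elim,
      (hMK (h𝓜t (ht.mem_of_pair_mem hy))).elim, h.eq_of_pair_mem hx hy]
  · intro M x hx M' hM' hMM' hnext
    -- The mixed cases: a value of `ft` is a subset of `K`, hence of any model of `𝓜` outside `K`;
    -- and a model outside `K` cannot belong to a model of `𝓜t`, all of which are subsets of `K`.
    rcases hmem.1 hx with hx | ⟨hx, hMK⟩ <;> rcases hcases hM' with hM' | ⟨hM', hMK'⟩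
    · exact ht.value_next M x hx M' hM' hMM' fun M'' hM'' =>
        hnext M'' (ZFSet.mem_union.2 (.inl hM''))
    · exact (hft M x hx).trans (habove hM' hMK')
    · exact (hMK (subset_of_mem_models (ht.subset hM') hKm (h𝓜t hM') hMM')).elim
    · exact h.value_next M x hx M' hM' hMM' fun M'' hM'' =>
        hnext M'' (ZFSet.mem_union.2 (.inr hM''))

theorem extends_amalgam_left {𝓜 f 𝓜t ft K : ZFSet.{u}}
    (ht : IsCondition lt₁ 𝓜t ft) (h𝓜t : 𝓜t ⊆ K) :
    Extends (𝓜t ∪ 𝓜) (ft ∪ restrict f (· ∉ K)) 𝓜t ft := by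
  refine ⟨fun z hz => ZFSet.mem_union.2 (.inl hz), fun M hM x x' hx hx' => ?_⟩
  rw [ZFSet.mem_union, pair_mem_restrict] at hx'
  rcases hx' with hx' | ⟨-, hMK⟩
  · rw [ht.eq_of_pair_mem hx hx']
  · exact (hMK (h𝓜t hM)).elim

theorem extends_amalgam_right {𝓜 f 𝓜t ft K : ZFSet.{u}} (h : IsCondition lt₁ 𝓜 f)
    (ht : IsCondition lt₁ 𝓜t ft) (h𝓜t : 𝓜t ⊆ K)
    (hext : Extends 𝓜t ft (𝓜 ∩ K) (restrict f (· ∈ K))) :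
    Extends (𝓜t ∪ 𝓜) (ft ∪ restrict f (· ∉ K)) 𝓜 f := by
  refine ⟨fun z hz => ZFSet.mem_union.2 (.inr hz), fun M hM x x' hx hx' => ?_⟩
  rw [ZFSet.mem_union, pair_mem_restrict] at hx'
  rcases hx' with hx' | ⟨hx', -⟩
  · have hMK := h𝓜t (ht.mem_of_pair_mem hx')
    exact hext.2 M (ZFSet.mem_inter.2 ⟨hM, hMK⟩) x x' (pair_mem_restrict.2 ⟨hx, hMK⟩) hx'
  · rw [h.eq_of_pair_mem hx hx']

/-! ### Strong genericity -/

section Generic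

variable {κ : Cardinal.{u}} {lt : H κ → H κ → Prop} {N : ZFSet.{u}}

theorem IsCondition.subset_inter_of_mem {𝓜 f : ZFSet.{u}} (h : IsCondition lt₁ 𝓜 f)
    (hN : IsElementary N (H κ) lt) (hκ : κ.IsRegular) (h₀ : ℵ₀ < κ) (hp : ZFSet.pair 𝓜 f ∈ N) :
    𝓜 ⊆ N ∩ H ℵ₁ := fun _ hM =>
  ZFSet.mem_inter.2 ⟨hN.subset_of_countable hκ h₀ (hN.of_pair_mem hκ h₀ hp).1 h.finite.countable hM,
    mem_H_of_mem_models (h.subset hM)⟩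

theorem IsCondition.value_subset_inter_of_mem {𝓜 f M x : ZFSet.{u}} (h : IsCondition lt₁ 𝓜 f)
    (hN : IsElementary N (H κ) lt) (hκ : κ.IsRegular) (h₀ : ℵ₀ < κ) (hp : ZFSet.pair 𝓜 f ∈ N)
    (hx : ZFSet.pair M x ∈ f) : x ⊆ N ∩ H ℵ₁ := by
  have hM := h.subset_inter_of_mem hN hκ h₀ hp (h.mem_of_pair_mem hx)
  have hxN : x ∈ N := hN.apply_mem (hN.of_pair_mem hκ h₀ hp).2 (ZFSet.mem_inter.1 hM).1 hx
    fun z hz => h.eq_of_pair_mem hz hx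
  obtain ⟨hfin, hxH⟩ := h.value M x hx
  exact fun z hz => ZFSet.mem_inter.2
    ⟨hN.subset_of_countable hκ h₀ hxN hfin.countable hz, hxH hz⟩

/-- This is where the bound on the values of `f` is used: for `M ∈ K`, the finite set `f(M)` is
included in `K` by `value_subset`, hence is an element of `N`. The restriction is then assembled
from finite subsets of `N`. -/
theorem IsCondition.restrict_mem {𝓜 f : ZFSet.{u}} (h : IsCondition lt₁ 𝓜 f)
    (hN : IsElementary N (H κ) lt) (hκ : κ.IsRegular) (h₀ : ℵ₀ < κ) (hK : N ∩ H ℵ₁ ∈ 𝓜) :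
    ZFSet.pair (𝓜 ∩ (N ∩ H ℵ₁)) (AbrahamForcing.restrict f (· ∈ N ∩ H ℵ₁)) ∈ N := by
  have hr := h.restrict hK
  have hmemN {z : ZFSet.{u}} (hz : z ∈ N ∩ H ℵ₁) : z ∈ N := (ZFSet.mem_inter.1 hz).1
  refine hN.pair_mem hκ h₀ (hN.mem_of_finite hκ h₀
    (fun z hz => hmemN (ZFSet.mem_inter.1 hz).2) hr.finite) (hN.mem_of_finite hκ h₀ ?_ ?_)
  · intro z hz
    obtain ⟨M, x, rfl⟩ := hr.exists_eq_pair hz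
    obtain ⟨hx, hMK⟩ := pair_mem_restrict.1 hz
    exact hN.pair_mem hκ h₀ (hmemN hMK) (hN.mem_of_finite hκ h₀
      (fun z hz => hmemN (h.value_subset hK hx hMK hz)) (h.value M x hx).1)
  · choose! g hg using fun M (hM : M ∈ 𝓜) => h.exists_pair_mem hM
    refine (h.finite.image fun M => ZFSet.pair M (g M)).subset fun z hz => ?_
    obtain ⟨M, x, rfl⟩ := hr.exists_eq_pair hz
    have hx := (pair_mem_restrict.1 hz).1
    have hM := h.mem_of_pair_mem hx
    exact ⟨M, hM, by rw [h.eq_of_pair_mem hx (hg M hM)]⟩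

theorem isStronglyGeneric_insert_top (hκ : κ.IsRegular) (hN : IsElementary N (H κ) lt)
    (hNc : (N : Set ZFSet.{u}).Countable)
    (hPR : ZFSet.pair (conditions lt₁) (order lt₁) ∈ N) {𝓜 f : ZFSet.{u}}
    (h : IsCondition lt₁ 𝓜 f) (hp : ZFSet.pair 𝓜 f ∈ N) :
    ZFSet.pair
        (ZFSet.pair (insert (N ∩ H ℵ₁) 𝓜) (insert (ZFSet.pair (N ∩ H ℵ₁) ∅) f))
        (ZFSet.pair 𝓜 f) ∈ order lt₁ ∧
      IsStronglyGeneric (conditions lt₁) (order lt₁) N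
        (ZFSet.pair (insert (N ∩ H ℵ₁) 𝓜) (insert (ZFSet.pair (N ∩ H ℵ₁) ∅) f)) := by
  have h₀ : ℵ₀ < κ := aleph0_lt_of_conditions_mem hκ (of_pair_mem_H (hN.subset hPR)).1
  have hK := hN.inter_mem_models hκ h₀ hNc (hN.of_pair_mem hκ h₀ hPR).1
  have h𝓜 := h.subset_inter_of_mem hN hκ h₀ hp
  have hp' := h.insert_top hK h𝓜 fun M x hx => h.value_subset_inter_of_mem hN hκ h₀ hp hx
  refine ⟨pair_mem_order.2 ⟨hp', h, extends_insert_top h h𝓜⟩, pair_mem_conditions.2 hp', ?_⟩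
  intro D hD r hrP hrp
  obtain ⟨𝓜r, fr, rfl, hr⟩ := exists_of_mem_conditions hrP
  have hKr : N ∩ H ℵ₁ ∈ 𝓜r := (pair_mem_order.1 hrp).2.2.1 (ZFSet.mem_insert _ _)
  -- Density is applied to the restriction of `r` to `K`, the trace of `r` in ℙ ∩ `N`.
  obtain ⟨t, htD, htr⟩ := hD.dense _ (ZFSet.mem_inter.2
    ⟨pair_mem_conditions.2 (hr.restrict hKr), hr.restrict_mem hN hκ h₀ hKr⟩)
  obtain ⟨htP, htN⟩ := ZFSet.mem_inter.1 (hD.subset t htD)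
  obtain ⟨𝓜t, ft, rfl, ht⟩ := exists_of_mem_conditions htP
  have hext := (pair_mem_order.1 htr).2.2
  have h𝓜t := ht.subset_inter_of_mem hN hκ h₀ htN
  have hs := hr.amalgam hKr ht h𝓜t
    (fun M x hx => ht.value_subset_inter_of_mem hN hκ h₀ htN hx) hext.1
  exact ⟨_, pair_mem_conditions.2 hs, _, htD,
    pair_mem_order.2 ⟨hs, hr, extends_amalgam_right hr ht h𝓜t hext⟩,
    pair_mem_order.2 ⟨hs, ht, extends_amalgam_left ht h𝓜t⟩⟩

end Generic

theorem isClub_countable (A : ZFSet.{u}) :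
    IsClub A {X | X ⊆ A ∧ (X : Set ZFSet.{u}).Countable} where
  subset := fun _ h => h
  unbounded := fun X hX hc => ⟨X, ⟨hX, hc⟩, fun _ => id⟩
  closed := by
    intro X hX _
    refine ⟨fun z hz => ?_, ?_⟩
    · obtain ⟨n, hn⟩ := ZFSet.mem_iUnion.1 hz
      exact (hX n).1 hn
    · rw [ZFSet.coe_iUnion]
      exact Set.countable_iUnion fun n => (hX n).2

/-- Genericity holds for every countable elementary `N` containing the forcing, so the club can
consist of all countable subsets of `H κ`. -/
theorem stronglyProper_order : StronglyProper (conditions lt₁) (order lt₁) := by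
  intro κ hκ _ lt _
  refine ⟨_, isClub_countable (H κ), fun N hN hNe hPR p hp => ?_⟩
  obtain ⟨hpP, hpN⟩ := ZFSet.mem_inter.1 hp
  obtain ⟨𝓜, f, rfl, h⟩ := exists_of_mem_conditions hpP
  exact ⟨_, isStronglyGeneric_insert_top hκ hNe hN.2 hPR h hpN⟩

end

end AbrahamForcing

open AbrahamForcing Cardinal in
theorem mainTheorem2 (lt₁ : H.{u} ℵ₁ → H.{u} ℵ₁ → Prop) (hlt₁ : IsWellOrder (H.{u} ℵ₁) lt₁) :
    IsForcing (conditions lt₁) (order lt₁) ∧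
    StronglyProper (conditions lt₁) (order lt₁) ∧
    ∀ κ : Cardinal.{u}, κ.IsRegular → LargeEnough (conditions lt₁) (order lt₁) κ →
    ∀ lt : H κ → H κ → Prop, IsWellOrder (H κ) lt →
    ∀ N : ZFSet.{u}, (N : Set ZFSet.{u}).Countable → IsElementary N (H κ) lt →
    ZFSet.pair (conditions lt₁) (order lt₁) ∈ N →
    ∀ 𝓜 f : ZFSet.{u}, ZFSet.pair 𝓜 f ∈ conditions lt₁ → ZFSet.pair 𝓜 f ∈ N →
      ZFSet.pair
          (ZFSet.pair (insert (N ∩ H ℵ₁) 𝓜) (insert (ZFSet.pair (N ∩ H ℵ₁) ∅) f))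
          (ZFSet.pair 𝓜 f) ∈ order lt₁ ∧
        IsStronglyGeneric (conditions lt₁) (order lt₁) N
          (ZFSet.pair (insert (N ∩ H ℵ₁) 𝓜) (insert (ZFSet.pair (N ∩ H ℵ₁) ∅) f)) := by
  exact ⟨isForcing_order, stronglyProper_order, fun κ hκ _ lt _ N hNc hN hPR 𝓜 f hp hpN =>
    isStronglyGeneric_insert_top hκ hN hNc hPR (pair_mem_conditions.1 hp) hpN⟩
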